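/- The topos of trees $\mathcal S$ is the category whose objects $X$ are families of sets $X_1, X_2, \dots$ with restriction functions $X_{i+1}\to X_i$, and whose arrows are natural families of functions. Let $\Delta:\mathbf{Set}\to\mathcal S$ send a set $Z$ to $Z\xleftarrow{\mathrm{id}}Z\xleftarrow{\mathrm{id}}\cdots$, let $1=\Delta\{*\}$, let $\blacksquare=\Delta\circ\mathrm{Hom}_{\mathcal S}(1,-)$, and let $\mathsf{unbox}:\blacksquare\to\mathrm{id}$ be the counit of the adjunction $\Delta\dashv\mathrm{Hom}_{\mathcal S}(1,-)$, that is, $\mathsf{unbox}_i(x)=x_i(*)$. An object is constant if it is isomorphic to some $\Delta Z$. Propositions in context $\Gamma$ are interpreted as subobjects of $\Gamma$ as usual in the internal logic of $\mathcal S$: $s=_A t$ is the equalizer of the arrows $s,t:\Gamma\to A$, $\Rightarrow$ and $\lnot$ are the Heyting operations on $\mathrm{Sub}(\Gamma)$, and a proposition is valid if it is the top element of $\mathrm{Sub}(\Gamma)$. The modality $\square:\mathrm{Sub}(\Gamma)\to\mathrm{Sub}(\Gamma)$ ("always") is the right adjoint of $\lnot\lnot$. (For constant $\Gamma$ this means: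 $x\in\Gamma_m$ lies in $\square Y$ if and only if $x\in Y_m$ and $x$ has the same height in $Y$ as in $\Gamma$, where the height of $x$ is the largest $n\ge m$ such that $x$ is the restriction of an element at stage $n$, or $\infty$ if there is no largest such $n$.) **Lemma 3.9.** For every object $A$ of $\mathcal S$, the formula $$\square(\mathsf{unbox}\,x =_A \mathsf{unbox}\,y)\;\Rightarrow\; x =_{\blacksquare A} y$$ is valid, where $x,y:\blacksquare A$ are variables, i.e. in the context $\blacksquare A\times\blacksquare A$ with $x,y$ the two projections. More generally, it is valid for all terms $x,y:\blacksquare A$ in a constant context, i.e. for every constant object $\Gamma$ and all arrows $x,y:\Gamma\to\blacksquare A$, as a proposition in context $\Gamma$. -/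

import Mathlib

open CategoryTheory Opposite MonoidalCategory CartesianMonoidalCategory

universe u

/-- The topos of trees: families of sets `X 1, X 2, …` indexed by the positive integers, with
restriction maps `X j → X i` for `i ≤ j`; arrows are natural families of functions. -/
abbrev Trees : Type (u + 1) := ℕ+ᵒᵖ ⥤ Type u

namespace Trees

/-! ### The comonad `■` and its counit `unbox` -/

/-- The functor `Δ : Set ⥤ Trees`, sending a set `Z` to `Z ← Z ← Z ← ⋯` (identity maps). -/
abbrev Δ : Type u ⥤ Trees.{u} := Functor.const ℕ+ᵒᵖ

/-- The terminal object `1 = Δ {∗}`. -/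
abbrev one : Trees.{u} := Δ.obj PUnit

/-- The global elements functor `hom(1, -)`. -/
abbrev globalElements : Trees.{u} ⥤ Type u := coyoneda.obj (op one)

/-- `Δ` is left adjoint to the global elements functor. -/
def adj : Δ.{u} ⊣ globalElements.{u} :=
  Adjunction.mkOfUnitCounit
    { unit := { app := fun Z => ↾fun z => { app := fun _ => ↾fun _ => z } }
      counit :=
        { app := fun X =>
            { app := fun n => ↾fun (x : one ⟶ X) => x.app n PUnit.unit
              naturality := fun m n f => by
                ext x
                exact NatTrans.naturality_apply x f PUnit.unit } } }

/-- The endofunctor `■ = Δ ∘ hom(1, -)`. -/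
abbrev box : Trees.{u} ⥤ Trees.{u} := globalElements ⋙ Δ

/-- `unbox : ■ ⟶ id` is the counit of the comonad associated with `Δ ⊣ hom(1, -)`. -/
def unbox : box.{u} ⟶ 𝟭 Trees.{u} := adj.counit

/-- Concretely, `unbox_n (x) = x_n`. -/
theorem unbox_app_app (X : Trees.{u}) (n : ℕ+ᵒᵖ) (x : one ⟶ X) :
    (unbox.app X).app n x = x.app n PUnit.unit := rfl

/-- The constant objects: those isomorphic to some `Δ Z`. -/
def IsConstant (X : Trees.{u}) : Prop := ∃ Z : Type u, Nonempty (X ≅ Δ.obj Z)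

/-! ### Propositions of the internal logic

A proposition in context `X` is a subobject of `X`, i.e. a family of subsets of the `X n` that is
closed under restriction (Mathlib's `Subfunctor X`). It is valid if it is the whole of `X`. -/

/-- The subobjects of `X` form a complete Heyting algebra, for the inclusion order; its operations
`⇨` and `ᶜ` interpret implication and negation. -/
instance (X : Trees.{u}) : Order.Frame (Subfunctor X) :=
  Order.Frame.ofMinimalAxioms
    { inf_sSup_le_iSup_inf := fun a s => by
        rw [inf_comm, sSup_eq_iSup', Subfunctor.iSup_min, iSup_subtype]
        simp only [inf_comm, le_refl] }

/-- The proposition `f =_A g` for terms `f, g` of type `A` in context `X`: the equalizer of `f` and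
`g`, as a subobject of `X`. -/
def eqProp {X A : Trees.{u}} (f g : X ⟶ A) : Subfunctor X where
  obj n := {x | f.app n x = g.app n x}
  map {m n} i x (h : f.app m x = g.app m x) := by
    show f.app n (X.map i x) = g.app n (X.map i x)
    rw [NatTrans.naturality_apply, NatTrans.naturality_apply, h]

/-- The modality `□` ('always') on subobjects of `X`: the right adjoint of double negation. -/
def always {X : Trees.{u}} (Y : Subfunctor X) : Subfunctor X := sSup {Z | Zᶜᶜ ≤ Y}

/-! ### `□` is the right adjoint of `¬¬`, and is given by heights over constant objects -/

/-- The first stage. -/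
abbrev first : ℕ+ᵒᵖ := op 1

/-- Restriction to the first stage. -/
abbrev toFirst (n : ℕ+ᵒᵖ) : n ⟶ first := (homOfLE (one_le : 1 ≤ n.unop)).op

theorem mem_compl_iff {X : Trees.{u}} (Y : Subfunctor X) (n : ℕ+ᵒᵖ) (x : X.obj n) :
    x ∈ Yᶜ.obj n ↔ X.map (toFirst n) x ∉ Y.obj first := by
  constructor
  · intro h h'
    have h1 : X.map (toFirst n) x ∈ (Yᶜ ⊓ Y).obj first := ⟨Yᶜ.map _ h, h'⟩
    rw [compl_inf_self] at h1
    exact h1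
  · intro h
    let Z : Subfunctor X :=
      { obj := fun m => {z | X.map (toFirst m) z ∉ Y.obj first}
        map := fun {m k} i z hz => by
          show X.map (toFirst k) (X.map i z) ∉ _
          rw [← Functor.map_comp_apply]
          exact hz }
    have hZ : Z ≤ Yᶜ := by
      rw [le_compl_iff_disjoint_right, disjoint_iff_inf_le]
      rintro m z ⟨hz, hz'⟩
      exact (hz (Y.map _ hz')).elim
    exact hZ n h

theorem mem_compl_compl_iff {X : Trees.{u}} (Y : Subfunctor X) (n : ℕ+ᵒᵖ) (x : X.obj n) :
    x ∈ Yᶜᶜ.obj n ↔ X.map (toFirst n) x ∈ Y.obj first := by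
  rw [mem_compl_iff, mem_compl_iff, not_not, ← Functor.map_comp_apply]
  rfl

/-- `□` is right adjoint to double negation. -/
theorem gc_always (X : Trees.{u}) :
    GaloisConnection (fun Y : Subfunctor X => Yᶜᶜ) always := by
  intro Z Y
  refine ⟨fun h => le_sSup h, fun h n x hx => ?_⟩
  rw [mem_compl_compl_iff] at hx
  have := h _ hx
  simp only [always, Subfunctor.sSup_obj, Set.sSup_eq_sUnion, Set.sUnion_image,
    Set.mem_iUnion] at this
  obtain ⟨W, hW, hxW⟩ := this
  exact hW n ((mem_compl_compl_iff W n x).2 hxW)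

/-- Concretely: `x` is in `□ Y` if and only if every element over the first stage of `x` is in `Y`. -/
theorem mem_always_iff {X : Trees.{u}} (Y : Subfunctor X) (n : ℕ+ᵒᵖ) (x : X.obj n) :
    x ∈ (always Y).obj n ↔
      ∀ (m : ℕ+ᵒᵖ) (z : X.obj m), X.map (toFirst m) z = X.map (toFirst n) x → z ∈ Y.obj m := by
  constructor
  · intro hx m z hz
    refine (gc_always X).l_u_le Y m ((mem_compl_compl_iff _ m z).2 ?_)
    rw [hz]
    exact (always Y).map _ hx
  · intro h
    let Z : Subfunctor X :=
      { obj := fun k => {w | X.map (toFirst k) w = X.map (toFirst n) x}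
        map := fun {k l} i w hw => by
          show X.map (toFirst l) (X.map i w) = _
          rw [← Functor.map_comp_apply]
          exact hw }
    have hZ : Z ≤ always Y := (gc_always X).le_u (fun m z hz => h m z (by
      have h1 := (mem_compl_compl_iff Z m z).1 hz
      change X.map (toFirst first) (X.map (toFirst m) z) = _ at h1
      rw [← Functor.map_comp_apply] at h1
      exact h1))
    exact hZ n rfl

/-- The restriction maps of a constant object are bijections. -/
theorem IsConstant.bijective {X : Trees.{u}} (hX : IsConstant X) {m n : ℕ+ᵒᵖ} (f : m ⟶ n) :
    Function.Bijective (X.map f) := by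
  obtain ⟨Z, ⟨e⟩⟩ := hX
  have : IsIso (X.map f) := by
    have h : X.map f = e.hom.app m ≫ e.inv.app n := by
      rw [← NatIso.naturality_2 e f]
      simp
    rw [h]
    exact IsIso.comp_isIso' (NatIso.hom_app_isIso e m) (NatIso.inv_app_isIso e n)
  exact (isIso_iff_bijective _).1 this

/-- The height in `Y`, for a subobject `Y` of `X`, of an element `x` at stage `m`: the largest
`n ≥ m` such that `x` is the restriction of an element of `Y n`, or `∞` if there is no largest one.
(For `x` not in `Y` there is no such `n`, and the value is `0`.) -/
noncomputable def height {X : Trees.{u}} (Y : Subfunctor X) {m : ℕ+} (x : X.obj (op m)) : ℕ∞ :=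
  sSup {k : ℕ∞ | ∃ (n : ℕ+) (h : m ≤ n), (∃ y ∈ Y.obj (op n), X.map (homOfLE h).op y = x) ∧
    k = ((n : ℕ) : ℕ∞)}

/-- Over a constant object, an element belongs to `□ Y` exactly when it belongs to `Y` and its
heights in `Y` and in `X` are equal. -/
theorem mem_always_iff_height {X : Trees.{u}} (hX : IsConstant X) (Y : Subfunctor X) {m : ℕ+}
    (x : X.obj (op m)) :
    x ∈ (always Y).obj (op m) ↔ x ∈ Y.obj (op m) ∧ height Y x = height ⊤ x := by
  have key : ∀ (n : ℕ+) (h : m ≤ n) (Y' : Subfunctor X), height Y' x = ⊤ →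
      ∀ y : X.obj (op n), X.map (homOfLE h).op y = x → y ∈ Y'.obj (op n) := by
    intro n h Y' ht y hy
    have hlt : ((n : ℕ) : ℕ∞) < height Y' x := by rw [ht]; exact ENat.natCast_lt_top _
    obtain ⟨_, ⟨k, hmk, ⟨w, hw, hwx⟩, rfl⟩, hnk⟩ := lt_sSup_iff.1 hlt
    have hnk' : n ≤ k := by
      have h1 : (n : ℕ) < (k : ℕ) := by exact_mod_cast hnk
      exact_mod_cast h1.le
    have hyw : X.map (homOfLE hnk').op w = y := by
      apply (hX.bijective (homOfLE h).op).1
      rw [← Functor.map_comp_apply, hy, ← hwx]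
      rfl
    rw [← hyw]
    exact Y'.map _ hw
  have hall : ∀ Y' : Subfunctor X,
      (∀ (n : ℕ+) (h : m ≤ n) (y : X.obj (op n)), X.map (homOfLE h).op y = x →
        y ∈ Y'.obj (op n)) → height Y' x = ⊤ := by
    intro Y' h
    refine ENat.eq_top_iff_forall_ge.2 fun k => ?_
    let n : ℕ+ := m + ⟨k + 1, Nat.succ_pos k⟩
    have hmn : m ≤ n := (PNat.lt_add_right _ _).le
    obtain ⟨y, hy⟩ := (hX.bijective (homOfLE hmn).op).2 x
    refine le_trans ?_ (le_sSup ⟨n, hmn, ⟨y, h n hmn y hy, hy⟩, rfl⟩)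
    have : k ≤ (n : ℕ) := by
      show k ≤ (m : ℕ) + (k + 1)
      omega
    exact_mod_cast this
  have htop : height ⊤ x = ⊤ := hall ⊤ fun _ _ _ _ => trivial
  rw [htop, mem_always_iff]
  constructor
  · intro h
    refine ⟨h _ x rfl, hall Y fun n hmn y hy => h _ y ?_⟩
    rw [← hy, ← Functor.map_comp_apply]
    rfl
  · rintro ⟨-, ht⟩ n z hz
    obtain ⟨n⟩ := n
    obtain ⟨w, hw⟩ := (hX.bijective (homOfLE (le_max_left m n)).op).2 x
    have h1 := key _ (le_max_left m n) Y ht w hw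
    have h2 : X.map (homOfLE (le_max_right m n)).op w = z := by
      apply (hX.bijective (toFirst (op n))).1
      rw [hz, ← hw, ← Functor.map_comp_apply, ← Functor.map_comp_apply]
      rfl
    rw [← h2]
    exact Y.map _ h1

end Trees

namespace Trees

/-! An element of `■A` is a whole global element of `A`, while `unbox` at stage `m` sees only its
`m`-th component. By `mem_always_iff`, `□` makes the unboxed equation hold at every element lying
over the same first-stage element as `w`. In a constant context there is such an element at each
stage `m`, and by `app_eq_of_toFirst_eq` the terms `x` and `y` have the same values there as at `w`.
Hence the global elements `x(w)` and `y(w)` agree in every component. -/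

theorem IsConstant.tensor {X Y : Trees.{u}} (hX : IsConstant X) (hY : IsConstant Y) :
    IsConstant (X ⊗ Y) := by
  obtain ⟨Z, ⟨e⟩⟩ := hX
  obtain ⟨W, ⟨f⟩⟩ := hY
  -- `Δ` preserves products: stage by stage the two sides coincide, so identities serve as
  -- components.
  exact ⟨Z ⊗ W, ⟨(e ⊗ᵢ f) ≪≫ NatIso.ofComponents (fun _ => Iso.refl _)⟩⟩

theorem isConstant_box (A : Trees.{u}) : IsConstant (box.obj A) :=
  ⟨one ⟶ A, ⟨Iso.refl _⟩⟩

/-- A term of type `■ A` takes the same value at elements with the same restriction to the first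
stage. -/
theorem app_eq_of_toFirst_eq {Γ A : Trees.{u}} (x : Γ ⟶ box.obj A) {m n : ℕ+ᵒᵖ}
    {z : Γ.obj m} {w : Γ.obj n} (h : Γ.map (toFirst m) z = Γ.map (toFirst n) w) :
    (x.app m z : one ⟶ A) = x.app n w := by
  -- Restrictions in `■A` are identities, so each naturality square equates the value of `x` with
  -- its value at the common first stage.
  have hz := NatTrans.naturality_apply x (toFirst m) z
  have hw := NatTrans.naturality_apply x (toFirst n) w
  rw [h] at hz
  exact hz.symm.trans hw

theorem always_eqProp_unbox_le {Γ A : Trees.{u}} (hΓ : IsConstant Γ) (x y : Γ ⟶ box.obj A) :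
    always (eqProp (x ≫ unbox.app A) (y ≫ unbox.app A)) ≤ eqProp x y := by
  intro n w hw
  rw [mem_always_iff] at hw
  change (x.app n w : one ⟶ A) = y.app n w
  refine NatTrans.ext (funext fun m => ?_)
  ext ⟨⟩
  -- Constancy is used only here, as surjectivity onto the first stage: it supplies `z` even when
  -- `m` is a later stage than that of `w`.
  obtain ⟨z, hz⟩ := (hΓ.bijective (toFirst m)).2 (Γ.map (toFirst n) w)
  rw [← app_eq_of_toFirst_eq x hz, ← app_eq_of_toFirst_eq y hz]
  -- Unfolding `unbox`, the equation at `z` is equality of the `m`-th components.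
  exact hw m z hz

end Trees

/-- Validity of `□ (unbox x =_A unbox y) ⇒ x =_{■A} y`: first for the variables `x, y : ■A`, in the
context `■A × ■A`, and then for arbitrary terms `x, y : ■A` in an arbitrary constant context `Γ`. -/
theorem lemma3p9 (A : Trees.{u}) :
    (Trees.always (Trees.eqProp
        (fst (Trees.box.obj A) (Trees.box.obj A) ≫ Trees.unbox.app A)
        (snd (Trees.box.obj A) (Trees.box.obj A) ≫ Trees.unbox.app A)) ⇨
      Trees.eqProp (fst (Trees.box.obj A) (Trees.box.obj A))
        (snd (Trees.box.obj A) (Trees.box.obj A))) = ⊤ ∧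
    ∀ (Γ : Trees.{u}), Trees.IsConstant Γ → ∀ x y : Γ ⟶ Trees.box.obj A,
      (Trees.always (Trees.eqProp (x ≫ Trees.unbox.app A) (y ≫ Trees.unbox.app A)) ⇨
        Trees.eqProp x y) = ⊤ := by
  simp only [himp_eq_top_iff]
  exact ⟨Trees.always_eqProp_unbox_le
      ((Trees.isConstant_box A).tensor (Trees.isConstant_box A)) _ _,
    fun _ hΓ x y => Trees.always_eqProp_unbox_le hΓ x y⟩
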